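/- **Conventions.** A *computad* consists of generators, each with a dimension $k\ge 0$, and for each generator of dimension $m+1$ a source and a target, which are parallel $m$-cells of the strict $m$-category freely generated by the generators of dimension $\le m$. A morphism of computads is a dimension-preserving map of generators compatible with sources and targets. The *odd opposite* $P^{\mathrm{odd}\,\mathrm{op}}$ of a computad $P$ has the same generators, with the direction of all $k$-cells reversed for every odd $k$: source and target are exchanged for cells of odd dimension, and composition along $n$-cells is reversed for even $n$. We write $a\circ_n b$ for "first $b$, then $a$", composed along $n$-cells. Let $\Theta^{(j)}$ be the walking $j$-morphism: its generators are its $k$-dimensional source $s_k$ and target $t_k$ for $0\le k<j$, and a generator of dimension $j$. A generator of dimension $m+1$ goes from $s_m$ to $t_m$. For $j=1$ write $a_-=s_0$, $a_+=t_0$ and $I$ for the top generator. The computad $\Theta^{(1);(j)}$ has as generators the pairs $(x,y)$ of a generator $x$ of $\Theta^{(1)}$ and a generator $y$ of $\Theta^{(j)}$, of dimension $\dim x+\dim y$. Here $(a_\pm,y)\colon(a_\pm,s_m)\to(a_\pm,t_m)$ if $\dim y=m+1$; $(I,y)\colon(a_-,y)\to(a_+,y)$ if $\dim y=0$; and, if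 $\dim y=m+1$, $$(I,y)\colon\ (I,t_m)\circ_m\overline{(a_-,y)}\ \longrightarrow\ \overline{(a_+,y)}\circ_m(I,s_m),$$ where the bar denotes whiskering by lower-dimensional generators: $$\overline{(a_-,y)}=(I,t_{m-1})\circ_{m-1}\bigl(\cdots\circ_1((I,t_0)\circ_0(a_-,y))\bigr),\qquad \overline{(a_+,y)}=\bigl(((a_+,y)\circ_0(I,s_0))\circ_1\cdots\bigr)\circ_{m-1}(I,s_{m-1}).$$ The computad $\Theta^{(j);(1)}$ has as generators the pairs $(y,x)$. Here $(y,a_\pm)\colon(s_m,a_\pm)\to(t_m,a_\pm)$ if $\dim y=m+1$; $(y,I)\colon(y,a_-)\to(y,a_+)$ if $\dim y=0$; and, if $\dim y=m+1$, $$(y,I)\colon\ \overline{(y,a_+)}\circ_m(s_m,I)\to(t_m,I)\circ_m\overline{(y,a_-)}\quad(m+1\text{ odd}),\qquad (y,I)\colon\ \overline{(y,a_-)}\circ_m(s_m,I)\to(t_m,I)\circ_m\overline{(y,a_+)}\quad(m+1\text{ even}).$$ The bar again denotes whiskering: successively for $i=0,\dots,m-1$, the cell built from $(y,a_+)$ is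 composed along $i$-cells with $(t_i,I)$ on the left if $i$ is odd and with $(s_i,I)$ on the right if $i$ is even; for $(y,a_-)$ the roles of odd and even are exchanged. The top generators are called $\theta_{1;j}\in\Theta^{(1);(j)}$ and $\theta_{j;1}\in\Theta^{(j);(1)}$. In $\Theta^{(1);(j)}$ let $s_h\theta_{0;j}$, $t_h\theta_{0;j}$ be the generators $(a_-,y)$, $(a_+,y)$ with $y$ the top generator of $\Theta^{(j)}$. In $\Theta^{(j);(1)}$ let $s_v\theta_{j;0}$, $t_v\theta_{j;0}$ be the generators $(y,a_-)$, $(y,a_+)$ with the same $y$. For $j\ge1$ the inclusions of the source and target of $\Theta^{(j)}$ induce inclusions $s_v,t_v\colon\Theta^{(1);(j-1)}\hookrightarrow\Theta^{(1);(j)}$ and $s_h,t_h\colon\Theta^{(j-1);(1)}\hookrightarrow\Theta^{(j);(1)}$. The images of the top generators are called $s_v\theta_{1;j-1}$, $t_v\theta_{1;j-1}$ and $s_h\theta_{j-1;1}$, $t_h\theta_{j-1;1}$. Thus $\theta_{1;j}$ goes, up to whiskering, from $t_v\theta_{1;j-1}\circ s_h\theta_{0;j}$ to $t_h\theta_{0;j}\circ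 s_v\theta_{1;j-1}$. The same notation is used for the generators of $(\Theta^{(1);(j)})^{\mathrm{odd}\,\mathrm{op}}$. **Lemma.** There are isomorphisms of computads $$\varphi_j\colon\left(\Theta^{(1);(j)}\right)^{\mathrm{odd}\,\mathrm{op}}\cong\Theta^{(j);(1)}\qquad(j\ge0)$$ such that $\theta_{1;j}\leftrightarrow\theta_{j;1}$, $s_h\theta_{0;j}\leftrightarrow t_v\theta_{j;0}$ and $t_h\theta_{0;j}\leftrightarrow s_v\theta_{j;0}$ for all $j$, and, for $j\ge1$: * if $j$ is odd, then $s_v\theta_{1;j-1}\leftrightarrow t_h\theta_{j-1;1}$ and $t_v\theta_{1;j-1}\leftrightarrow s_h\theta_{j-1;1}$; more generally $\varphi_j\circ s_v=t_h\circ\varphi_{j-1}$ and $\varphi_j\circ t_v=s_h\circ\varphi_{j-1}$; * if $j$ is even, then $s_v\theta_{1;j-1}\leftrightarrow s_h\theta_{j-1;1}$ and $t_v\theta_{1;j-1}\leftrightarrow t_h\theta_{j-1;1}$; more generally $\varphi_j\circ s_v=s_h\circ\varphi_{j-1}$ and $\varphi_j\circ t_v=t_h\circ\varphi_{j-1}$.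 -/

import Mathlib

open CategoryTheory

/-! ## Strict ω-categories

One-sorted strict ω-categories: a cell of dimension `n` is identified with its identity cells in all
higher dimensions.  `bd false n` is the `n`-dimensional source `s_n`, `bd true n` is the
`n`-dimensional target `t_n`, and `comp n a b` is the composite `a ∘ b` (first `b`, then `a`) along
`n`-dimensional cells.  It is meaningful only if `s_n a = t_n b`; its other values are junk. -/

/-- A strict ω-category in one-sorted form. -/
structure OmegaCat where
  Cell : Type
  bd : Bool → ℕ → Cell → Cell
  comp : ℕ → Cell → Cell → Cell
  finite_dim : ∀ a, ∃ n, ∀ ε, bd ε n a = a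
  bd_bd_lt : ∀ ε δ m n a, m < n → bd ε m (bd δ n a) = bd ε m a
  bd_bd_ge : ∀ ε δ m n a, m ≤ n → bd δ n (bd ε m a) = bd ε m a
  src_comp : ∀ n a b, bd false n a = bd true n b → bd false n (comp n a b) = bd false n b
  tgt_comp : ∀ n a b, bd false n a = bd true n b → bd true n (comp n a b) = bd true n a
  bd_comp : ∀ ε n m a b, n < m → bd false n a = bd true n b →
    bd ε m (comp n a b) = comp n (bd ε m a) (bd ε m b)
  comp_src : ∀ n a, comp n a (bd false n a) = a
  tgt_comp_self : ∀ n a, comp n (bd true n a) a = a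
  assoc : ∀ n a b c, bd false n a = bd true n b → bd false n b = bd true n c →
    comp n (comp n a b) c = comp n a (comp n b c)
  interchange : ∀ m n a b c d, m < n → bd false n a = bd true n b → bd false n c = bd true n d →
    bd false m a = bd true m c → bd false m b = bd true m d →
    comp m (comp n a b) (comp n c d) = comp n (comp m a c) (comp m b d)

/-! ## Formal composites and computads -/

/-- Formal expressions in the operations of a strict ω-category, with variables in `G`. -/
inductive CellTerm (G : Type) : Type
  | gen (g : G) : CellTerm G
  | bd (ε : Bool) (n : ℕ) (a : CellTerm G) : CellTerm G
  | comp (n : ℕ) (a b : CellTerm G) : CellTerm G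

namespace CellTerm

/-- Renaming of variables. -/
def map {G H : Type} (f : G → H) : CellTerm G → CellTerm H
  | gen g => gen (f g)
  | bd ε n a => bd ε n (map f a)
  | comp n a b => comp n (map f a) (map f b)

/-- The expression that denotes the same cell in the odd opposite, where the direction of the
`k`-cells is reversed for every odd `k`.  Sources and targets of dimension `n`, and the order of
composition along `n`-cells, are exchanged if and only if `n + 1` is odd. -/
def oddOp {G : Type} : CellTerm G → CellTerm G
  | gen g => gen g
  | bd ε n a => bd (xor ε (n + 1).bodd) n (oddOp a)
  | comp n a b => cond (n + 1).bodd (comp n (oddOp b) (oddOp a)) (comp n (oddOp a) (oddOp b))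

end CellTerm

/-- Raw data of a computad: generators with their dimensions, and for every generator `g` of
positive dimension formal expressions `bdry false g` for its source and `bdry true g` for its
target (the values for generators of dimension `0` play no role). -/
structure Precomputad where
  Gen : Type
  dim : Gen → ℕ
  bdry : Bool → Gen → CellTerm Gen

/-- `P.Eqv N a b`: both expressions are well-formed composites of generators of dimension `≤ N`, and
they denote the same cell of the strict `N`-category freely generated by these generators.  The rules
are the axioms of strict ω-categories, the rules of equality, and the equations which say that `g`
is a cell of dimension `dim g` with the prescribed source and target. -/
inductive Precomputad.Eqv (P : Precomputad) (N : ℕ) : CellTerm P.Gen → CellTerm P.Gen → Prop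
  | symm {a b} : P.Eqv N a b → P.Eqv N b a
  | trans {a b c} : P.Eqv N a b → P.Eqv N b c → P.Eqv N a c
  | gen (g) : P.dim g ≤ N → P.Eqv N (.gen g) (.gen g)
  | bd_congr (ε n) {a b} : P.Eqv N a b → P.Eqv N (.bd ε n a) (.bd ε n b)
  | comp_congr (n) {a a' b b'} : P.Eqv N a a' → P.Eqv N b b' →
      P.Eqv N (.bd false n a) (.bd true n b) → P.Eqv N (.comp n a b) (.comp n a' b')
  | bd_gen (ε n g) : P.dim g ≤ N → P.dim g ≤ n → P.Eqv N (.bd ε n (.gen g)) (.gen g)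
  | bd_bdry (ε n g) : P.dim g ≤ N → P.dim g = n + 1 →
      P.Eqv N (.bd ε n (.gen g)) (P.bdry ε g)
  | bd_bd_lt (ε δ) {m n a} : m < n → P.Eqv N a a →
      P.Eqv N (.bd ε m (.bd δ n a)) (.bd ε m a)
  | bd_bd_ge (ε δ) {m n a} : m ≤ n → P.Eqv N a a →
      P.Eqv N (.bd δ n (.bd ε m a)) (.bd ε m a)
  | src_comp {n a b} : P.Eqv N a a → P.Eqv N b b → P.Eqv N (.bd false n a) (.bd true n b) →
      P.Eqv N (.bd false n (.comp n a b)) (.bd false n b)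
  | tgt_comp {n a b} : P.Eqv N a a → P.Eqv N b b → P.Eqv N (.bd false n a) (.bd true n b) →
      P.Eqv N (.bd true n (.comp n a b)) (.bd true n a)
  | bd_comp (ε) {n m a b} : n < m → P.Eqv N a a → P.Eqv N b b →
      P.Eqv N (.bd false n a) (.bd true n b) →
      P.Eqv N (.bd ε m (.comp n a b)) (.comp n (.bd ε m a) (.bd ε m b))
  | comp_src (n) {a} : P.Eqv N a a → P.Eqv N (.comp n a (.bd false n a)) a
  | tgt_comp_self (n) {a} : P.Eqv N a a → P.Eqv N (.comp n (.bd true n a) a) a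
  | assoc {n a b c} : P.Eqv N a a → P.Eqv N b b → P.Eqv N c c →
      P.Eqv N (.bd false n a) (.bd true n b) → P.Eqv N (.bd false n b) (.bd true n c) →
      P.Eqv N (.comp n (.comp n a b) c) (.comp n a (.comp n b c))
  | interchange {m n a b c d} : m < n → P.Eqv N a a → P.Eqv N b b → P.Eqv N c c → P.Eqv N d d →
      P.Eqv N (.bd false n a) (.bd true n b) → P.Eqv N (.bd false n c) (.bd true n d) →
      P.Eqv N (.bd false m a) (.bd true m c) → P.Eqv N (.bd false m b) (.bd true m d) →
      P.Eqv N (.comp m (.comp n a b) (.comp n c d)) (.comp n (.comp m a c) (.comp m b d))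

namespace Precomputad

variable {P : Precomputad} {N : ℕ}

theorem Eqv.left {a b : CellTerm P.Gen} (h : P.Eqv N a b) : P.Eqv N a a := h.trans h.symm

theorem Eqv.right {a b : CellTerm P.Gen} (h : P.Eqv N a b) : P.Eqv N b b := h.symm.trans h

theorem Eqv.mono {a b : CellTerm P.Gen} (h : P.Eqv N a b) {M : ℕ} (hM : N ≤ M) : P.Eqv M a b := by
  induction h with
  | symm _ h => exact h.symm
  | trans _ _ h h2 => exact h.trans h2
  | gen g h => exact .gen g (h.trans hM)
  | bd_congr ε n _ h => exact .bd_congr ε n h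
  | comp_congr n _ _ _ h1 h2 h3 => exact .comp_congr n h1 h2 h3
  | bd_gen ε n g h h2 => exact .bd_gen ε n g (h.trans hM) h2
  | bd_bdry ε n g h h2 => exact .bd_bdry ε n g (h.trans hM) h2
  | bd_bd_lt ε δ h _ h1 => exact .bd_bd_lt ε δ h h1
  | bd_bd_ge ε δ h _ h1 => exact .bd_bd_ge ε δ h h1
  | src_comp _ _ _ h1 h2 h3 => exact .src_comp h1 h2 h3
  | tgt_comp _ _ _ h1 h2 h3 => exact .tgt_comp h1 h2 h3
  | bd_comp ε h _ _ _ h1 h2 h3 => exact .bd_comp ε h h1 h2 h3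
  | comp_src n _ h => exact .comp_src n h
  | tgt_comp_self n _ h => exact .tgt_comp_self n h
  | assoc _ _ _ _ _ h1 h2 h3 h4 h5 => exact .assoc h1 h2 h3 h4 h5
  | interchange h _ _ _ _ _ _ _ _ h1 h2 h3 h4 h5 h6 h7 h8 =>
    exact .interchange h h1 h2 h3 h4 h5 h6 h7 h8


/-- The source of a composite along cells of smaller dimension. -/
theorem Eqv.bd_comp_lt {n m : ℕ} {a b : CellTerm P.Gen} (hm : m < n) (ha : P.Eqv N a a)
    (hb : P.Eqv N b b) (h : P.Eqv N (.bd false n a) (.bd true n b)) :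
    P.Eqv N (.bd false m (.comp n a b)) (.bd false m b) ∧
      P.Eqv N (.bd true m (.comp n a b)) (.bd true m a) := by
  have hc : P.Eqv N (.comp n a b) (.comp n a b) := .comp_congr n ha hb h
  exact ⟨((Eqv.bd_bd_lt false false hm hc).symm.trans (.bd_congr _ _ (.src_comp ha hb h))).trans
      (.bd_bd_lt _ _ hm hb),
    ((Eqv.bd_bd_lt true true hm hc).symm.trans (.bd_congr _ _ (.tgt_comp ha hb h))).trans
      (.bd_bd_lt _ _ hm ha)⟩

/-- Every well-formed composite of generators of dimension `≤ N` is a cell of dimension `≤ N`. -/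
theorem Eqv.bd_self {a b : CellTerm P.Gen} (h : P.Eqv N a b) (ε : Bool) :
    P.Eqv N (.bd ε N a) a ∧ P.Eqv N (.bd ε N b) b := by
  have hbd : ∀ {ε δ m a}, P.Eqv N (.bd ε N a) a → P.Eqv N (.bd ε N (.bd δ m a)) (.bd δ m a) := by
    intro ε δ m a ha
    rcases le_total m N with hm | hm
    · exact .bd_bd_ge _ _ hm ha.right
    · have h1 : P.Eqv N (.bd δ m a) a :=
        ((Eqv.bd_congr δ m ha.symm).trans (.bd_bd_ge _ _ hm ha.right)).trans ha
      exact ((Eqv.bd_congr ε N h1).trans ha).trans h1.symm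
  have hcomp : ∀ {n a b}, (∀ ε, P.Eqv N (.bd ε N a) a) → (∀ ε, P.Eqv N (.bd ε N b) b) →
      P.Eqv N (.bd false n a) (.bd true n b) →
      ∀ ε, P.Eqv N (.bd ε N (.comp n a b)) (.comp n a b) := by
    intro n a b ha hb hab ε
    have ha' := (ha ε).right
    have hb' := (hb ε).right
    have hc : P.Eqv N (.comp n a b) (.comp n a b) := .comp_congr n ha' hb' hab
    rcases lt_or_ge n N with hn | hn
    · refine (Eqv.bd_comp ε hn ha' hb' hab).trans (.symm ?_)
      exact .comp_congr n (ha ε).symm (hb ε).symm hab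
    · have h0 : ∀ δ c, (∀ ε, P.Eqv N (.bd ε N c) c) → P.Eqv N (.bd δ n c) c := fun δ c h =>
        ((Eqv.bd_congr δ n (h true).symm).trans (.bd_bd_ge _ _ hn (h true).right)).trans (h true)
      have h1 : P.Eqv N b (.bd false n a) := (hab.trans (h0 true b hb)).symm
      have h2 : P.Eqv N (.comp n a b) a := (Eqv.comp_congr n ha' h1 hab).trans (.comp_src n ha')
      exact ((Eqv.bd_congr ε N h2).trans (ha ε)).trans h2.symm
  revert ε
  suffices H : (∀ ε, P.Eqv N (.bd ε N a) a) ∧ ∀ ε, P.Eqv N (.bd ε N b) b from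
    fun ε => ⟨H.1 ε, H.2 ε⟩
  induction h with
  | symm _ h => exact ⟨h.2, h.1⟩
  | trans _ _ h h2 => exact ⟨h.1, h2.2⟩
  | gen g h => exact ⟨fun ε => .bd_gen ε N g h h, fun ε => .bd_gen ε N g h h⟩
  | bd_congr ε n _ h => exact ⟨fun _ => hbd (h.1 _), fun _ => hbd (h.2 _)⟩
  | comp_congr n h1 h2 h3 i1 i2 _ =>
    exact ⟨hcomp i1.1 i2.1 h3, hcomp i1.2 i2.2
      (((Eqv.bd_congr _ _ h1).symm.trans h3).trans (.bd_congr _ _ h2))⟩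
  | bd_gen ε n g h h2 =>
    exact ⟨fun _ => hbd (.bd_gen _ N g h h), fun ε => .bd_gen ε N g h h⟩
  | bd_bdry ε n g h h2 =>
    have h1 : P.Eqv N (.bd ε n (.gen g)) (P.bdry ε g) := .bd_bdry ε n g h h2
    have h3 : ∀ δ, P.Eqv N (.bd δ N (.bd ε n (.gen g))) (.bd ε n (.gen g)) :=
      fun _ => hbd (.bd_gen _ N g h h)
    exact ⟨h3, fun δ => ((Eqv.bd_congr δ N h1).symm.trans (h3 δ)).trans h1⟩
  | bd_bd_lt ε δ h _ h1 => exact ⟨fun _ => hbd (hbd (h1.1 _)), fun _ => hbd (h1.1 _)⟩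
  | bd_bd_ge ε δ h _ h1 => exact ⟨fun _ => hbd (hbd (h1.1 _)), fun _ => hbd (h1.1 _)⟩
  | src_comp _ _ h1 h2 h3 => exact ⟨fun _ => hbd (hcomp h2.1 h3.1 h1 _), fun _ => hbd (h3.1 _)⟩
  | tgt_comp _ _ h1 h2 h3 => exact ⟨fun _ => hbd (hcomp h2.1 h3.1 h1 _), fun _ => hbd (h2.1 _)⟩
  | bd_comp ε hnm ha hb hab h1 h2 h3 =>
    have := Eqv.bd_comp ε hnm ha hb hab
    exact ⟨fun _ => hbd (hcomp h1.1 h2.1 hab _), fun δ =>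
      ((Eqv.bd_congr δ N this).symm.trans (hbd (hcomp h1.1 h2.1 hab _))).trans this⟩
  | comp_src n h h1 =>
    exact ⟨fun δ => ((Eqv.bd_congr δ N (.comp_src n h)).trans (h1.1 δ)).trans
      (Eqv.comp_src n h).symm, h1.1⟩
  | tgt_comp_self n h h1 =>
    exact ⟨fun δ => ((Eqv.bd_congr δ N (.tgt_comp_self n h)).trans (h1.1 δ)).trans
      (Eqv.tgt_comp_self n h).symm, h1.1⟩
  | assoc ha hb hc h1 h2 ia ib ic _ _ =>
    have h := Eqv.assoc ha hb hc h1 h2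
    have h3 := hcomp ia.1 (hcomp ib.1 ic.1 h2) (h1.trans (.symm (.tgt_comp hb hc h2)))
    exact ⟨fun δ => ((Eqv.bd_congr δ N h).trans (h3 δ)).trans h.symm, h3⟩
  | interchange h ha hb hc hd h1 h2 h3 h4 ia ib ic id _ _ _ _ =>
    have h5 := Eqv.interchange h ha hb hc hd h1 h2 h3 h4
    have h6 := hcomp (hcomp ia.1 ib.1 h1) (hcomp ic.1 id.1 h2)
      (((Eqv.bd_comp_lt h ha hb h1).1.trans h4).trans
        (((Eqv.bd_bd_lt true true h hd).symm.trans (.bd_congr _ _ h2.symm)).trans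
          ((Eqv.bd_bd_lt true false h hc).trans (Eqv.bd_comp_lt h hc hd h2).2.symm)))
    exact ⟨h6, fun δ => ((Eqv.bd_congr δ N h5).symm.trans (h6 δ)).trans h5⟩

/-- Well-formed expressions up to equality in the free category. -/
def cellSetoid (P : Precomputad) (N : ℕ) : Setoid {a : CellTerm P.Gen // P.Eqv N a a} where
  r a b := P.Eqv N a.1 b.1
  iseqv := ⟨fun a => a.2, fun h => h.symm, fun h h2 => h.trans h2⟩

/-- The strict `N`-category freely generated by the generators of dimension `≤ N`. -/
noncomputable def freeCat (P : Precomputad) (N : ℕ) : OmegaCat := by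
  classical
  let C := Quotient (P.cellSetoid N)
  let bd : Bool → ℕ → C → C := fun ε n => Quotient.map
    (fun a => ⟨.bd ε n a.1, .bd_congr ε n a.2⟩) (fun _ _ h => Eqv.bd_congr ε n h)
  let comp : ℕ → C → C → C := fun n x y =>
    if h : P.Eqv N (.bd false n x.out.1) (.bd true n y.out.1) then
      ⟦⟨.comp n x.out.1 y.out.1, .comp_congr n x.out.2 y.out.2 h⟩⟧ else x
  have hout : ∀ a : {a : CellTerm P.Gen // P.Eqv N a a},
      P.Eqv N (Quotient.out (⟦a⟧ : C)).1 a.1 := fun a => Quotient.mk_out (s := P.cellSetoid N) a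
  have hcomp : ∀ n (a b : {a : CellTerm P.Gen // P.Eqv N a a})
      (h : P.Eqv N (.bd false n a.1) (.bd true n b.1)),
      comp n ⟦a⟧ ⟦b⟧ = ⟦⟨.comp n a.1 b.1, .comp_congr n a.2 b.2 h⟩⟧ := by
    intro n a b h
    have h1 : P.Eqv N (.bd false n (Quotient.out (⟦a⟧ : C)).1)
        (.bd true n (Quotient.out (⟦b⟧ : C)).1) :=
      ((Eqv.bd_congr _ _ (hout a)).trans h).trans (.bd_congr _ _ (hout b).symm)
    simp only [comp, dif_pos h1]
    exact Quotient.sound (Eqv.comp_congr n (hout a) (hout b) h1)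
  have hex : ∀ {a b : {a : CellTerm P.Gen // P.Eqv N a a}}, (⟦a⟧ : C) = ⟦b⟧ → P.Eqv N a.1 b.1 :=
    fun h => Quotient.exact h
  refine { Cell := C, bd := bd, comp := comp, finite_dim := ?_, bd_bd_lt := ?_, bd_bd_ge := ?_,
           src_comp := ?_, tgt_comp := ?_, bd_comp := ?_, comp_src := ?_, tgt_comp_self := ?_,
           assoc := ?_, interchange := ?_ }
  · rintro ⟨a⟩
    exact ⟨N, fun ε => Quotient.sound (a.2.bd_self ε).1⟩
  · rintro ε δ m n ⟨a⟩ h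
    exact Quotient.sound (Eqv.bd_bd_lt ε δ h a.2)
  · rintro ε δ m n ⟨a⟩ h
    exact Quotient.sound (Eqv.bd_bd_ge ε δ h a.2)
  · rintro n ⟨a⟩ ⟨b⟩ h
    have h' := hex h
    exact (congrArg (bd false n) (hcomp n a b h')).trans
      (Quotient.sound (Eqv.src_comp a.2 b.2 h'))
  · rintro n ⟨a⟩ ⟨b⟩ h
    have h' := hex h
    exact (congrArg (bd true n) (hcomp n a b h')).trans
      (Quotient.sound (Eqv.tgt_comp a.2 b.2 h'))
  · rintro ε n m ⟨a⟩ ⟨b⟩ hnm h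
    have h' := hex h
    have h2 := Eqv.bd_comp ε hnm a.2 b.2 h'
    refine (congrArg (bd ε m) (hcomp n a b h')).trans ((Quotient.sound h2).trans
      (hcomp n ⟨_, .bd_congr ε m a.2⟩ ⟨_, .bd_congr ε m b.2⟩ ?_).symm)
    exact ((Eqv.bd_bd_lt _ _ hnm a.2).trans h').trans (Eqv.bd_bd_lt _ _ hnm b.2).symm
  · rintro n ⟨a⟩
    refine (hcomp n a ⟨_, .bd_congr false n a.2⟩ ?_).trans (Quotient.sound (Eqv.comp_src n a.2))
    exact (Eqv.bd_bd_ge false true le_rfl a.2).symm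
  · rintro n ⟨a⟩
    refine (hcomp n ⟨_, .bd_congr true n a.2⟩ a ?_).trans
      (Quotient.sound (Eqv.tgt_comp_self n a.2))
    exact Eqv.bd_bd_ge true false le_rfl a.2
  · rintro n ⟨a⟩ ⟨b⟩ ⟨c⟩ hab hbc
    have h1 := hex hab
    have h2 := hex hbc
    refine (congrArg (fun x => comp n x ⟦c⟧) (hcomp n a b h1)).trans
      ((hcomp n ⟨_, .comp_congr n a.2 b.2 h1⟩ c ?_).trans
      ((Quotient.sound (Eqv.assoc a.2 b.2 c.2 h1 h2)).trans
      ((hcomp n a ⟨_, .comp_congr n b.2 c.2 h2⟩ ?_).symm.trans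
      (congrArg (fun x => comp n ⟦a⟧ x) (hcomp n b c h2)).symm)))
    · exact (Eqv.src_comp a.2 b.2 h1).trans h2
    · exact h1.trans (Eqv.tgt_comp b.2 c.2 h2).symm
  · rintro m n ⟨a⟩ ⟨b⟩ ⟨c⟩ ⟨d⟩ hmn hab hcd hac hbd
    have h1 := hex hab
    have h2 := hex hcd
    have h3 := hex hac
    have h4 := hex hbd
    have e := Eqv.interchange hmn a.2 b.2 c.2 d.2 h1 h2 h3 h4
    refine (congrArg₂ (comp m) (hcomp n a b h1) (hcomp n c d h2)).trans
      ((hcomp m ⟨_, .comp_congr n a.2 b.2 h1⟩ ⟨_, .comp_congr n c.2 d.2 h2⟩ ?_).trans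
      ((Quotient.sound e).trans
      ((hcomp n ⟨_, .comp_congr m a.2 c.2 h3⟩ ⟨_, .comp_congr m b.2 d.2 h4⟩ ?_).symm.trans
      (congrArg₂ (comp n) (hcomp m a c h3) (hcomp m b d h4)).symm)))
    · refine (Eqv.bd_comp_lt hmn a.2 b.2 h1).1.trans (h4.trans ?_)
      exact ((Eqv.bd_bd_lt true true hmn d.2).symm.trans (.bd_congr _ _ h2.symm)).trans
        ((Eqv.bd_bd_lt true false hmn c.2).trans (Eqv.bd_comp_lt hmn c.2 d.2 h2).2.symm)
    · refine (Eqv.bd_comp false hmn a.2 c.2 h3).trans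
        (.trans ?_ (Eqv.bd_comp true hmn b.2 d.2 h4).symm)
      exact .comp_congr m h1 h2 (((Eqv.bd_bd_lt _ _ hmn a.2).trans h3).trans
        (Eqv.bd_bd_lt _ _ hmn c.2).symm)

/-- The cell of the free strict `N`-category that a well-formed expression denotes. -/
noncomputable def cell (P : Precomputad) (N : ℕ) (a : CellTerm P.Gen) (h : P.Eqv N a a) :
    (P.freeCat N).Cell :=
  (⟦⟨a, h⟩⟧ : Quotient (P.cellSetoid N))

theorem cell_eq_iff {a b : CellTerm P.Gen} (ha : P.Eqv N a a) (hb : P.Eqv N b b) :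
    P.cell N a ha = P.cell N b hb ↔ P.Eqv N a b :=
  Quotient.eq (r := P.cellSetoid N)

theorem bd_cell (ε : Bool) (n : ℕ) {a : CellTerm P.Gen} (ha : P.Eqv N a a) :
    (P.freeCat N).bd ε n (P.cell N a ha) = P.cell N (.bd ε n a) (.bd_congr ε n ha) :=
  rfl

end Precomputad

/-- A computad: the source and target of a generator of dimension `m + 1` are well-formed composites
of generators of dimension `≤ m`, and they are parallel as cells of the strict `m`-category freely
generated by these. -/
structure Computad extends Precomputad where
  wf : ∀ ε g m, dim g = m + 1 → toPrecomputad.Eqv m (bdry ε g) (bdry ε g)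
  parallel : ∀ δ g m k (h : dim g = m + 1), k < m →
    (toPrecomputad.freeCat m).bd δ k (toPrecomputad.cell m (bdry false g) (wf false g m h)) =
    (toPrecomputad.freeCat m).bd δ k (toPrecomputad.cell m (bdry true g) (wf true g m h))

namespace Computad

theorem parallel_eqv (P : Computad) (δ : Bool) (g : P.Gen) {m k : ℕ} (h : P.dim g = m + 1)
    (hk : k < m) : P.Eqv m (.bd δ k (P.bdry false g)) (.bd δ k (P.bdry true g)) :=
  (Precomputad.cell_eq_iff _ _).1 (P.parallel δ g m k h hk)

/-- A morphism of computads: a dimension-preserving map of generators that is compatible with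
sources and targets. -/
@[ext]
structure Hom (P Q : Computad) where
  toFun : P.Gen → Q.Gen
  dim_eq : ∀ g, Q.dim (toFun g) = P.dim g
  bdry_eqv : ∀ ε g m, P.dim g = m + 1 →
    Q.Eqv m ((P.bdry ε g).map toFun) (Q.bdry ε (toFun g))

end Computad

theorem CellTerm.map_id {G : Type} (a : CellTerm G) : a.map (fun g => g) = a := by
  induction a with
  | gen g => rfl
  | bd ε n a h => simp only [CellTerm.map, h]
  | comp n a b h1 h2 => simp only [CellTerm.map, h1, h2]

theorem CellTerm.map_map {G H K : Type} (f : G → H) (f2 : H → K) (a : CellTerm G) :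
    (a.map f).map f2 = a.map (fun g => f2 (f g)) := by
  induction a with
  | gen g => rfl
  | bd ε n a h => simp only [CellTerm.map, h]
  | comp n a b h1 h2 => simp only [CellTerm.map, h1, h2]

theorem Computad.Hom.map_eqv {P Q : Computad} (f : P.Hom Q) {N : ℕ} {a b : CellTerm P.Gen}
    (h : P.Eqv N a b) : Q.Eqv N (a.map f.toFun) (b.map f.toFun) := by
  induction h with
  | symm _ h => exact h.symm
  | trans _ _ h h2 => exact h.trans h2
  | gen g h => exact .gen _ ((f.dim_eq g).trans_le h)
  | bd_congr ε n _ h => exact .bd_congr ε n h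
  | comp_congr n _ _ _ h1 h2 h3 => exact .comp_congr n h1 h2 h3
  | bd_gen ε n g h h2 => exact .bd_gen ε n _ ((f.dim_eq g).trans_le h) ((f.dim_eq g).trans_le h2)
  | bd_bdry ε n g h h2 =>
    exact (Precomputad.Eqv.bd_bdry ε n _ ((f.dim_eq g).trans_le h) ((f.dim_eq g).trans h2)).trans
      ((f.bdry_eqv ε g n h2).symm.mono (by omega))
  | bd_bd_lt ε δ h _ h1 => exact .bd_bd_lt ε δ h h1
  | bd_bd_ge ε δ h _ h1 => exact .bd_bd_ge ε δ h h1
  | src_comp _ _ _ h1 h2 h3 => exact .src_comp h1 h2 h3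
  | tgt_comp _ _ _ h1 h2 h3 => exact .tgt_comp h1 h2 h3
  | bd_comp ε h _ _ _ h1 h2 h3 => exact .bd_comp ε h h1 h2 h3
  | comp_src n _ h => exact .comp_src n h
  | tgt_comp_self n _ h => exact .tgt_comp_self n h
  | assoc _ _ _ _ _ h1 h2 h3 h4 h5 => exact .assoc h1 h2 h3 h4 h5
  | interchange h _ _ _ _ _ _ _ _ h1 h2 h3 h4 h5 h6 h7 h8 =>
    exact .interchange h h1 h2 h3 h4 h5 h6 h7 h8

/-- The category of computads. -/
instance : Category Computad where
  Hom := Computad.Hom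
  id P := ⟨fun g => g, fun _ => rfl, fun ε g m h => by
    rw [CellTerm.map_id]; exact P.wf ε g m h⟩
  comp {P Q R} f f2 := ⟨fun g => f2.toFun (f.toFun g),
    fun g => (f2.dim_eq _).trans (f.dim_eq g), fun ε g m h => by
      rw [← CellTerm.map_map]
      exact (f2.map_eqv (f.bdry_eqv ε g m h)).trans (f2.bdry_eqv ε _ m ((f.dim_eq g).trans h))⟩

/-! ## The odd opposite -/

/-- The raw data of the odd opposite: the same generators, with source and target exchanged for the
generators of odd dimension, and with all composites read in the odd opposite. -/
def Precomputad.oddOp (P : Precomputad) : Precomputad where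
  Gen := P.Gen
  dim := P.dim
  bdry ε g := (P.bdry (xor ε (P.dim g).bodd) g).oddOp

theorem Precomputad.Eqv.oddOp {P : Precomputad} {N : ℕ} {a b : CellTerm P.Gen}
    (h : P.Eqv N a b) : P.oddOp.Eqv N a.oddOp b.oddOp := by
  induction h with
  | symm _ h => exact h.symm
  | trans _ _ h h2 => exact h.trans h2
  | gen g h => exact .gen (P := P.oddOp) _ h
  | bd_congr ε n _ h => exact .bd_congr _ n h
  | comp_congr n _ _ _ h1 h2 h3 =>
    simp only [CellTerm.oddOp] at h3 ⊢
    cases hn : (n + 1).bodd <;> simp only [hn, cond_true, cond_false, Bool.xor_true,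
      Bool.xor_false, Bool.not_true, Bool.not_false] at h3 ⊢
    · exact .comp_congr n h1 h2 h3
    · exact .comp_congr n h2 h1 h3.symm
  | bd_gen ε n g h h2 => exact .bd_gen (P := P.oddOp) _ n _ h h2
  | bd_bdry ε n g h h2 =>
    have := Eqv.bd_bdry (P := P.oddOp) (xor ε (n + 1).bodd) n g h h2
    have e : P.oddOp.bdry (xor ε (n + 1).bodd) g = (P.bdry ε g).oddOp := by
      change (P.bdry _ g).oddOp = _
      rw [h2]; congr 2; cases ε <;> cases (n + 1).bodd <;> rfl
    rw [e] at this
    exact this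
  | bd_bd_lt ε δ h _ h1 => exact .bd_bd_lt _ _ h h1
  | bd_bd_ge ε δ h _ h1 => exact .bd_bd_ge _ _ h h1
  | @src_comp n _ _ _ _ _ h1 h2 h3 =>
    simp only [CellTerm.oddOp] at h3 ⊢
    cases hn : (n + 1).bodd <;> simp only [hn, cond_true, cond_false, Bool.xor_true,
      Bool.xor_false, Bool.not_true, Bool.not_false] at h3 ⊢
    · exact .src_comp h1 h2 h3
    · exact .tgt_comp h2 h1 h3.symm
  | @tgt_comp n _ _ _ _ _ h1 h2 h3 =>
    simp only [CellTerm.oddOp] at h3 ⊢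
    cases hn : (n + 1).bodd <;> simp only [hn, cond_true, cond_false, Bool.xor_true,
      Bool.xor_false, Bool.not_true, Bool.not_false] at h3 ⊢
    · exact .tgt_comp h1 h2 h3
    · exact .src_comp h2 h1 h3.symm
  | @bd_comp ε n _ _ _ h _ _ _ h1 h2 h3 =>
    simp only [CellTerm.oddOp] at h3 ⊢
    cases hn : (n + 1).bodd <;> simp only [hn, cond_true, cond_false, Bool.xor_true,
      Bool.xor_false, Bool.not_true, Bool.not_false] at h3 ⊢
    · exact .bd_comp _ h h1 h2 h3
    · exact .bd_comp _ h h2 h1 h3.symm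
  | comp_src n _ h =>
    simp only [CellTerm.oddOp]
    cases hn : (n + 1).bodd <;> simp only [cond_true, cond_false, Bool.xor_true,
      Bool.xor_false, Bool.not_false]
    · exact .comp_src n h
    · exact .tgt_comp_self n h
  | tgt_comp_self n _ h =>
    simp only [CellTerm.oddOp]
    cases hn : (n + 1).bodd <;> simp only [cond_true, cond_false, Bool.xor_true,
      Bool.xor_false, Bool.not_true]
    · exact .tgt_comp_self n h
    · exact .comp_src n h
  | @assoc n _ _ _ _ _ _ _ _ h1 h2 h3 h4 h5 =>
    simp only [CellTerm.oddOp] at h4 h5 ⊢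
    cases hn : (n + 1).bodd <;> simp only [hn, cond_true, cond_false, Bool.xor_true,
      Bool.xor_false, Bool.not_true, Bool.not_false] at h4 h5 ⊢
    · exact .assoc h1 h2 h3 h4 h5
    · exact (Eqv.assoc h3 h2 h1 h5.symm h4.symm).symm
  | @interchange m n _ _ _ _ h _ _ _ _ _ _ _ _ h1 h2 h3 h4 h5 h6 h7 h8 =>
    simp only [CellTerm.oddOp] at h5 h6 h7 h8 ⊢
    cases hn : (n + 1).bodd <;> cases hm : (m + 1).bodd <;>
      simp only [hn, hm, cond_true, cond_false, Bool.xor_true,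
      Bool.xor_false, Bool.not_true, Bool.not_false] at h5 h6 h7 h8 ⊢
    · exact .interchange h h1 h2 h3 h4 h5 h6 h7 h8
    · exact .interchange h h3 h4 h1 h2 h6 h5 h7.symm h8.symm
    · exact .interchange h h2 h1 h4 h3 h5.symm h6.symm h8 h7
    · exact .interchange h h4 h3 h2 h1 h6.symm h5.symm h8.symm h7.symm

/-- A computad from raw data whose boundaries satisfy the required equations. -/
def Computad.ofEqv (P : Precomputad)
    (wf : ∀ ε g m, P.dim g = m + 1 → P.Eqv m (P.bdry ε g) (P.bdry ε g))
    (parallel : ∀ δ g m k, P.dim g = m + 1 → k < m →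
      P.Eqv m (.bd δ k (P.bdry false g)) (.bd δ k (P.bdry true g))) : Computad where
  toPrecomputad := P
  wf := wf
  parallel δ g m k h hk := (Precomputad.cell_eq_iff _ _).2 (parallel δ g m k h hk)

/-- The odd opposite of a computad. -/
def Computad.oddOp (P : Computad) : Computad :=
  .ofEqv P.toPrecomputad.oddOp (fun ε g m h => (P.wf _ g m h).oddOp) fun δ g m k h hk => by
    have h1 := (P.parallel_eqv (xor δ (k + 1).bodd) g h hk).oddOp
    have h2 : xor (xor δ (k + 1).bodd) (k + 1).bodd = δ := by
      cases δ <;> cases (k + 1).bodd <;> rfl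
    simp only [CellTerm.oddOp, h2] at h1
    simp only [Precomputad.oddOp]
    cases (P.dim g).bodd
    · exact h1
    · exact h1.symm

theorem CellTerm.map_oddOp {G H : Type} (f : G → H) (a : CellTerm G) :
    a.oddOp.map f = (a.map f).oddOp := by
  induction a with
  | gen g => rfl
  | bd ε n a h => simp only [CellTerm.map, CellTerm.oddOp, h]
  | comp n a b h1 h2 =>
    simp only [CellTerm.map, CellTerm.oddOp]
    cases (n + 1).bodd <;> simp only [cond_true, cond_false, CellTerm.map, h1, h2]

/-- The odd opposite of a morphism of computads: the same map of generators. -/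
def Computad.oddOpMap {P Q : Computad} (f : P ⟶ Q) : P.oddOp ⟶ Q.oddOp where
  toFun := @Computad.Hom.toFun P Q f
  dim_eq := @Computad.Hom.dim_eq P Q f
  bdry_eqv ε g m h := by
    have h1 := (@Computad.Hom.bdry_eqv P Q f (xor ε (P.dim g).bodd) g m h).oddOp
    rw [← CellTerm.map_oddOp, ← @Computad.Hom.dim_eq P Q f g] at h1
    have h2 : P.dim g = Q.dim (@Computad.Hom.toFun P Q f g) := (@Computad.Hom.dim_eq P Q f g).symm
    change Q.toPrecomputad.oddOp.Eqv m ((P.bdry (xor ε (P.dim g).bodd) g).oddOp.map _) _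
    rw [h2]
    exact h1

/-! ## Whiskering

`whisker I left k x` composes `x` successively with one generator in each of the dimensions
`1, …, k`: along `m`-cells, with `I m true` on the left (after) if `left m` holds, and with
`I m false` on the right (before) otherwise. -/

def whisker {G : Type} (I : ℕ → Bool → G) (left : ℕ → Bool) : ℕ → CellTerm G → CellTerm G
  | 0, x => x
  | m + 1, x => cond (left m)
      (.comp m (.gen (I m true)) (whisker I left m x))
      (.comp m (whisker I left m x) (.gen (I m false)))

theorem map_whisker {G H : Type} (f : G → H) (I : ℕ → Bool → G) (I2 : ℕ → Bool → H)
    (left : ℕ → Bool) (k : ℕ) (x : CellTerm G) (h : ∀ m < k, ∀ ε, f (I m ε) = I2 m ε) :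
    (whisker I left k x).map f = whisker I2 left k (x.map f) := by
  induction k with
  | zero => rfl
  | succ m ih =>
    have h1 := ih fun i hi => h i (by omega)
    simp only [whisker]
    cases left m <;> simp only [cond_true, cond_false, CellTerm.map, h1, h m (by omega)]

section

variable {P : Precomputad} {k : ℕ} {σ : ℕ → Bool} {I : ℕ → Bool → P.Gen}
  {E : Bool → ℕ → Bool → P.Gen}

theorem whisker_eqv (hdim : ∀ m < k, ∀ ε, P.dim (I m ε) = m + 1)
    (hbd : ∀ m < k, ∀ β ε, P.bdry β (I m ε) = whisker I (fun i => !(xor (xor β (σ m)) (σ i))) m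
      (.gen (E (xor β (σ m)) m ε)))
    (δ : Bool) {m : ℕ} (hm : m ≤ k) {x y : CellTerm P.Gen} (hxy : P.Eqv k x y)
    (hx : ∀ i < m, ∀ ε, P.Eqv k (.bd ε i x) (.gen (E δ i ε))) :
    P.Eqv k (whisker I (fun i => !(xor δ (σ i))) m x) (whisker I (fun i => !(xor δ (σ i))) m y) ∧
    (∀ p, m ≤ p → ∀ ε, P.Eqv k (.bd ε p (whisker I (fun i => !(xor δ (σ i))) m x))
      (whisker I (fun i => !(xor δ (σ i))) m (.bd ε p x))) ∧
    ∀ i, m = i + 1 → ∀ β, P.Eqv k (.bd β i (whisker I (fun i => !(xor δ (σ i))) m x))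
      (whisker I (fun t => !(xor (xor β (σ i)) (σ t))) i (.gen (E (xor β (σ i)) i β))) := by
  induction m generalizing x y with
  | zero => exact ⟨hxy, fun p _ ε => .bd_congr ε p hxy.left, fun i hi => by omega⟩
  | succ m ih =>
    have hmk : m < k := hm
    obtain ⟨w1, w2, -⟩ := ih hmk.le hxy fun i hi => hx i (by omega)
    -- the boundary of the whiskered cell in dimension `m`
    have w3 : ∀ β, P.Eqv k (.bd β m (whisker I (fun i => !(xor δ (σ i))) m x))
        (whisker I (fun i => !(xor δ (σ i))) m (.gen (E δ m β))) := fun β =>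
      (w2 m le_rfl β).trans (ih hmk.le (hx m (by omega) β) fun i hi ε =>
        (Precomputad.Eqv.bd_bd_lt _ _ hi hxy.left).trans (hx i (by omega) ε)).1
    have hI : ∀ ε, P.Eqv k (.gen (I m ε)) (.gen (I m ε)) := fun ε =>
      .gen _ (by rw [hdim m hmk ε]; exact hmk)
    have hIb : ∀ β ε, P.Eqv k (.bd β m (.gen (I m ε))) (whisker I
        (fun i => !(xor (xor β (σ m)) (σ i))) m (.gen (E (xor β (σ m)) m ε))) := fun β ε => by
      rw [← hbd m hmk β ε]
      exact .bd_bdry β m _ (by rw [hdim m hmk ε]; exact hmk) (hdim m hmk ε)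
    have hIp : ∀ β ε p, m + 1 ≤ p → P.Eqv k (.bd β p (.gen (I m ε))) (.gen (I m ε)) :=
      fun β ε p hp => .bd_gen β p _ (by rw [hdim m hmk ε]; exact hmk) (by rw [hdim m hmk ε]; exact hp)
    by_cases hδ : δ = σ m
    · have hl : (!(xor δ (σ m))) = true := by subst hδ; simp
      have hc : P.Eqv k (.bd false m (.gen (I m true)))
          (.bd true m (whisker I (fun i => !(xor δ (σ i))) m x)) := by
        refine (hIb false true).trans ?_
        have := (w3 true).symm
        rw [hδ] at this ⊢
        simpa using this
      simp only [whisker, hl, cond_true]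
      refine ⟨.comp_congr m (hI _) w1 hc, fun p hp ε => ?_, fun i hi β => ?_⟩
      · exact (Precomputad.Eqv.bd_comp ε hp (hI _) w1.left hc).trans
          (.comp_congr m (hIp _ _ p hp) (w2 p (by omega) ε)
            (((Precomputad.Eqv.bd_bd_lt _ _ hp (hI _)).trans hc).trans
              (Precomputad.Eqv.bd_bd_lt _ _ hp w1.left).symm))
      · obtain rfl : m = i := by omega
        cases β
        · refine (Precomputad.Eqv.src_comp (hI _) w1.left hc).trans ?_
          have := w3 false
          rw [hδ] at this ⊢
          simpa using this
        · exact (Precomputad.Eqv.tgt_comp (hI _) w1.left hc).trans (hIb true true)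
    · have hδ2 : δ = !(σ m) := by revert hδ; cases δ <;> cases σ m <;> simp
      have hl : (!(xor δ (σ m))) = false := by rw [hδ2]; simp
      have hc : P.Eqv k (.bd false m (whisker I (fun i => !(xor δ (σ i))) m x))
          (.bd true m (.gen (I m false))) := by
        refine .trans ?_ (hIb true false).symm
        have := w3 false
        rw [hδ2] at this ⊢
        simpa using this
      simp only [whisker, hl, cond_false]
      refine ⟨.comp_congr m w1 (hI _) hc, fun p hp ε => ?_, fun i hi β => ?_⟩
      · exact (Precomputad.Eqv.bd_comp ε hp w1.left (hI _) hc).trans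
          (.comp_congr m (w2 p (by omega) ε) (hIp _ _ p hp)
            (((Precomputad.Eqv.bd_bd_lt _ _ hp w1.left).trans hc).trans
              (Precomputad.Eqv.bd_bd_lt _ _ hp (hI _)).symm))
      · obtain rfl : m = i := by omega
        cases β
        · exact (Precomputad.Eqv.src_comp w1.left (hI _) hc).trans (hIb false false)
        · refine (Precomputad.Eqv.tgt_comp w1.left (hI _) hc).trans ?_
          have := w3 true
          rw [hδ2] at this ⊢
          simpa using this

end

/-! ## The walking `1`-by-`j`- and `j`-by-`1`-morphisms -/

/-- The generators of the walking `j`-morphism `Θ^{(j)}`: a `k`-dimensional source (`ε = false`)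
and a `k`-dimensional target (`ε = true`) for every `k < j`, and one generator of dimension `j`. -/
inductive GlobeGen (j : ℕ) : Type
  | face (k : Fin j) (ε : Bool) : GlobeGen j
  | top : GlobeGen j

namespace GlobeGen

def dim {j : ℕ} : GlobeGen j → ℕ
  | face k _ => k
  | top => j

/-- The `m`-dimensional source or target of the top generator, which is `top` itself if `m ≥ j`. -/
def bdTop (j m : ℕ) (ε : Bool) : GlobeGen j :=
  if h : m < j then face ⟨m, h⟩ ε else top

/-- The inclusion of the source (`ε = false`) or target (`ε = true`) of the walking
`(j + 1)`-morphism. -/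
def incl {j : ℕ} (ε : Bool) : GlobeGen j → GlobeGen (j + 1)
  | face k δ => face k.castSucc δ
  | top => face (Fin.last j) ε

theorem dim_face {j : ℕ} (k : Fin j) (ε : Bool) : (face k ε).dim = k := rfl

theorem dim_top (j : ℕ) : (top : GlobeGen j).dim = j := rfl

theorem dim_bdTop {j m : ℕ} (h : m < j) (ε : Bool) : (bdTop j m ε).dim = m := by
  simp [bdTop, h, dim]

theorem dim_le {j : ℕ} (y : GlobeGen j) : y.dim ≤ j := by
  cases y with
  | face k ε => exact k.2.le
  | top => exact le_rfl

theorem dim_incl {j : ℕ} (ε : Bool) (y : GlobeGen j) : (y.incl ε).dim = y.dim := by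
  cases y <;> rfl

theorem incl_bdTop {j m : ℕ} (h : m < j) (ε δ : Bool) :
    (bdTop j m δ).incl ε = bdTop (j + 1) m δ := by
  simp [bdTop, h, Nat.lt_succ_of_lt h, incl]

end GlobeGen

open GlobeGen

/-- The generators of `Θ^{(1);(j)}` are the pairs `(x, y)` of generators of `Θ^{(1)}` and `Θ^{(j)}`.
* `(face 0 δ, y)` with `y` of dimension `m + 1` goes from `(face 0 δ, s_m)` to `(face 0 δ, t_m)`,
  where `s_m`, `t_m` are the `m`-dimensional source and target in `Θ^{(j)}`.
* `(top, y)` with `y` of dimension `0` goes from `(face 0 false, y)` to `(face 0 true, y)`.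
* `(top, y)` with `y` of dimension `m + 1` goes from `(top, t_m) ∘ (face 0 false, y)` to
  `(face 0 true, y) ∘ (top, s_m)`, composed along `m`-cells, where `(face 0 false, y)` stands for
  `(top, t_{m-1}) ∘_{m-1} (⋯ ∘_1 ((top, t_0) ∘_0 (face 0 false, y)))` and `(face 0 true, y)` for
  `(((face 0 true, y) ∘_0 (top, s_0)) ∘_1 ⋯) ∘_{m-1} (top, s_{m-1})`.
For the top generator this is
`t_v θ_{1;j-1} ∘ s_h θ_{0;j} ⟶ t_h θ_{0;j} ∘ s_v θ_{1;j-1}`. -/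
def preThetaOneBy (j : ℕ) : Precomputad where
  Gen := GlobeGen 1 × GlobeGen j
  dim g := g.1.dim + g.2.dim
  bdry ε g := match g with
    | (face k δ, y) => .gen (face k δ, bdTop j (y.dim - 1) ε)
    | (top, y) => whisker (fun m η => (top, bdTop j m η)) (fun _ => !ε) y.dim
        (.gen (face 0 ε, y))

/-- The generators of `Θ^{(j);(1)}` are the pairs `(y, x)` of generators of `Θ^{(j)}` and `Θ^{(1)}`.
* `(y, face 0 δ)` with `y` of dimension `m + 1` goes from `(s_m, face 0 δ)` to `(t_m, face 0 δ)`,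
  where `s_m`, `t_m` are the `m`-dimensional source and target in `Θ^{(j)}`.
* `(y, top)` with `y` of dimension `0` goes from `(y, face 0 false)` to `(y, face 0 true)`.
* `(y, top)` with `y` of odd dimension `m + 1` goes from `(y, face 0 true) ∘ (s_m, top)` to
  `(t_m, top) ∘ (y, face 0 false)`, composed along `m`-cells, and for even `m + 1` from
  `(y, face 0 false) ∘ (s_m, top)` to `(t_m, top) ∘ (y, face 0 true)`.  Here `(y, face 0 δ)` stands
for its whiskering in the dimensions `1, …, m`: successively for `i = 0, …, m - 1` it is composed
along `i`-cells, with `(t_i, top)` on the left if the whiskered `i`-dimensional faces of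
`(y, face 0 δ)` occur in the source of `(top of dimension i, top)`, that is, if `δ = true` and `i` is
odd or `δ = false` and `i` is even, and with `(s_i, top)` on the right otherwise.
For the top generator this is
`t_v θ_{j;0} ∘ s_h θ_{j-1;1} ⟶ t_h θ_{j-1;1} ∘ s_v θ_{j;0}` if `j` is odd, and
`s_v θ_{j;0} ∘ s_h θ_{j-1;1} ⟶ t_h θ_{j-1;1} ∘ t_v θ_{j;0}` if `j` is even. -/
def preThetaByOne (j : ℕ) : Precomputad where
  Gen := GlobeGen j × GlobeGen 1
  dim g := g.1.dim + g.2.dim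
  bdry ε g := match g with
    | (y, face k δ) => .gen (bdTop j (y.dim - 1) ε, face k δ)
    | (y, top) => whisker (fun m η => (bdTop j m η, top))
        (fun m => !(xor (xor ε y.dim.bodd) m.bodd)) y.dim (.gen (y, face 0 (xor ε y.dim.bodd)))

theorem preThetaOneBy_bd {j k : ℕ} (δ : Bool) (y : GlobeGen j) (hy : y.dim ≤ k) {i : ℕ}
    (hi : i < y.dim) (ε : Bool) :
    (preThetaOneBy j).Eqv k (.bd ε i (.gen (face 0 δ, y))) (.gen (face 0 δ, bdTop j i ε)) := by
  obtain ⟨n, hn⟩ : ∃ n, y.dim = n + 1 := ⟨y.dim - 1, by omega⟩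
  induction n generalizing y with
  | zero =>
    obtain rfl : i = 0 := by omega
    have := Precomputad.Eqv.bd_bdry (P := preThetaOneBy j) (N := k) ε 0 (face 0 δ, y)
      (by simpa [preThetaOneBy, dim_face, dim_top] using hy) (by simpa [preThetaOneBy, dim_face, dim_top] using hn)
    simpa [preThetaOneBy, hn] using this
  | succ n ih =>
    have hg : (preThetaOneBy j).dim (face 0 δ, y) = n + 1 + 1 := by
      simpa [preThetaOneBy, dim_face, dim_top] using hn
    have h1 : (preThetaOneBy j).Eqv k (.bd ε (n + 1) (.gen (face 0 δ, y)))
        (.gen (face 0 δ, bdTop j (n + 1) ε)) := by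
      have := Precomputad.Eqv.bd_bdry (P := preThetaOneBy j) (N := k) ε (n + 1) (face 0 δ, y)
        (by rw [hg]; omega) hg
      simpa [preThetaOneBy, hn] using this
    rcases Nat.lt_or_ge i (n + 1) with h | h
    · have hd : (bdTop j (n + 1) ε).dim = n + 1 := dim_bdTop (by have := y.dim_le; omega) ε
      exact ((Precomputad.Eqv.bd_bd_lt ε ε h (.gen _ (by rw [hg]; omega))).symm.trans
        (.bd_congr ε i h1)).trans (ih _ (by omega) (by omega) hd)
    · obtain rfl : i = n + 1 := by omega
      exact h1

theorem preThetaByOne_bd {j k : ℕ} (δ : Bool) (y : GlobeGen j) (hy : y.dim ≤ k) {i : ℕ}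
    (hi : i < y.dim) (ε : Bool) :
    (preThetaByOne j).Eqv k (.bd ε i (.gen (y, face 0 δ))) (.gen (bdTop j i ε, face 0 δ)) := by
  obtain ⟨n, hn⟩ : ∃ n, y.dim = n + 1 := ⟨y.dim - 1, by omega⟩
  induction n generalizing y with
  | zero =>
    obtain rfl : i = 0 := by omega
    have := Precomputad.Eqv.bd_bdry (P := preThetaByOne j) (N := k) ε 0 (y, face 0 δ)
      (by simpa [preThetaByOne, dim_face, dim_top] using hy) (by simpa [preThetaByOne, dim_face, dim_top] using hn)
    simpa [preThetaByOne, hn] using this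
  | succ n ih =>
    have hg : (preThetaByOne j).dim (y, face 0 δ) = n + 1 + 1 := by
      simpa [preThetaByOne, dim_face, dim_top] using hn
    have h1 : (preThetaByOne j).Eqv k (.bd ε (n + 1) (.gen (y, face 0 δ)))
        (.gen (bdTop j (n + 1) ε, face 0 δ)) := by
      have := Precomputad.Eqv.bd_bdry (P := preThetaByOne j) (N := k) ε (n + 1) (y, face 0 δ)
        (by rw [hg]; omega) hg
      simpa [preThetaByOne, hn] using this
    rcases Nat.lt_or_ge i (n + 1) with h | h
    · have hd : (bdTop j (n + 1) ε).dim = n + 1 := dim_bdTop (by have := y.dim_le; omega) ε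
      exact ((Precomputad.Eqv.bd_bd_lt ε ε h (.gen _ (by rw [hg]; omega))).symm.trans
        (.bd_congr ε i h1)).trans (ih _ (by omega) (by omega) hd)
    · obtain rfl : i = n + 1 := by omega
      exact h1

/-- The whiskered faces are well-formed, and their boundary does not depend on the face. -/
theorem preThetaOneBy_whisker {j : ℕ} (ε : Bool) (y : GlobeGen j) :
    (preThetaOneBy j).Eqv y.dim ((preThetaOneBy j).bdry ε (top, y))
      ((preThetaOneBy j).bdry ε (top, y)) ∧
    ∀ i, y.dim = i + 1 → ∀ β, (preThetaOneBy j).Eqv y.dim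
      (.bd β i ((preThetaOneBy j).bdry ε (top, y)))
      ((preThetaOneBy j).bdry β (top, bdTop j i β)) := by
  have hy := y.dim_le
  have hd : ∀ m < y.dim, ∀ ε, (bdTop j m ε).dim = m := fun m hm ε => dim_bdTop (by omega) ε
  have := whisker_eqv (P := preThetaOneBy j) (k := y.dim) (σ := fun _ => false)
    (I := fun m η => (top, bdTop j m η)) (E := fun δ m η => (face 0 δ, bdTop j m η))
    (fun m hm ε => by simp [preThetaOneBy, dim_top, hd m hm ε, add_comm])
    (fun m hm β η => by simp [preThetaOneBy, hd m hm η]) ε le_rfl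
    (Precomputad.Eqv.gen (P := preThetaOneBy j) (face 0 ε, y) (by simp [preThetaOneBy, dim_face]))
    (fun i hi η => preThetaOneBy_bd ε y le_rfl hi η)
  refine ⟨by simpa [preThetaOneBy] using this.1, fun i hi β => ?_⟩
  have h2 := this.2.2 i hi β
  have h3 := hd i (by omega) β
  simpa [preThetaOneBy, h3] using h2

/-- The whiskered faces are well-formed, and their boundary does not depend on the face. -/
theorem preThetaByOne_whisker {j : ℕ} (ε : Bool) (y : GlobeGen j) :
    (preThetaByOne j).Eqv y.dim ((preThetaByOne j).bdry ε (y, top))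
      ((preThetaByOne j).bdry ε (y, top)) ∧
    ∀ i, y.dim = i + 1 → ∀ β, (preThetaByOne j).Eqv y.dim
      (.bd β i ((preThetaByOne j).bdry ε (y, top)))
      ((preThetaByOne j).bdry β (bdTop j i β, top)) := by
  have hy := y.dim_le
  have hd : ∀ m < y.dim, ∀ ε, (bdTop j m ε).dim = m := fun m hm ε => dim_bdTop (by omega) ε
  have := whisker_eqv (P := preThetaByOne j) (k := y.dim) (σ := Nat.bodd)
    (I := fun m η => (bdTop j m η, top)) (E := fun δ m η => (bdTop j m η, face 0 δ))
    (fun m hm ε => by simp [preThetaByOne, dim_top, hd m hm ε])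
    (fun m hm β η => by simp [preThetaByOne, hd m hm η]) (xor ε y.dim.bodd) le_rfl
    (Precomputad.Eqv.gen (P := preThetaByOne j) (y, face 0 (xor ε y.dim.bodd))
      (by simp [preThetaByOne, dim_face]))
    (fun i hi η => preThetaByOne_bd _ y le_rfl hi η)
  refine ⟨by simpa [preThetaByOne] using this.1, fun i hi β => ?_⟩
  have h2 := this.2.2 i hi β
  have h3 := hd i (by omega) β
  simpa [preThetaByOne, h3] using h2

/-- Two cells whose boundaries agree in dimension `i` are parallel below. -/
theorem Precomputad.Eqv.parallel {P : Precomputad} {N i p : ℕ} {a b : CellTerm P.Gen}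
    (ha : P.Eqv N a a) (hb : P.Eqv N b b) (hp : p ≤ i) (δ : Bool)
    (h : P.Eqv N (.bd δ i a) (.bd δ i b)) : P.Eqv N (.bd δ p a) (.bd δ p b) := by
  rcases hp.lt_or_eq with hp | rfl
  · exact ((Eqv.bd_bd_lt δ δ hp ha).symm.trans (.bd_congr δ p h)).trans (.bd_bd_lt δ δ hp hb)
  · exact h

/-- The walking `1`-by-`j`-morphism `Θ^{(1);(j)}`. -/
def ThetaOneBy (j : ℕ) : Computad := .ofEqv (preThetaOneBy j)
  (fun ε g m h => by
    obtain ⟨x, y⟩ := g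
    have hy := y.dim_le
    cases x with
    | face q δ =>
      have h1 : y.dim = m + 1 := by
        obtain rfl : q = 0 := Subsingleton.elim _ _
        simpa [preThetaOneBy, dim_face, dim_top] using h
      refine .gen _ ?_
      obtain rfl : q = 0 := Subsingleton.elim _ _
      simp [preThetaOneBy, dim_face, h1, dim_bdTop (j := j) (m := m) (by omega) ε]
    | top =>
      have h1 : y.dim = m := by
        simp only [preThetaOneBy, dim_top] at h ⊢
        omega
      subst h1
      exact (preThetaOneBy_whisker ε y).1)
  (fun δ g m k h hk => by
    obtain ⟨x, y⟩ := g
    have hy := y.dim_le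
    cases x with
    | face q η =>
      obtain rfl : q = 0 := Subsingleton.elim _ _
      have h1 : y.dim = m + 1 := by simpa [preThetaOneBy, dim_face, dim_top] using h
      have hd : ∀ ε, (bdTop j m ε).dim = m := dim_bdTop (by omega)
      have := fun ε => preThetaOneBy_bd (k := m) η (bdTop j m ε) (hd ε).le (i := k)
        (by rw [hd]; exact hk) δ
      simpa [preThetaOneBy, h1] using (this false).trans (this true).symm
    | top =>
      have h1 : y.dim = m := by
        simp only [preThetaOneBy, dim_top] at h ⊢
        omega
      subst h1
      obtain ⟨i, hi⟩ : ∃ i, y.dim = i + 1 := ⟨y.dim - 1, by omega⟩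
      exact .parallel (preThetaOneBy_whisker false y).1 (preThetaOneBy_whisker true y).1
        (i := i) (by omega) δ (((preThetaOneBy_whisker false y).2 i hi δ).trans
          ((preThetaOneBy_whisker true y).2 i hi δ).symm))

/-- The walking `j`-by-`1`-morphism `Θ^{(j);(1)}`. -/
def ThetaByOne (j : ℕ) : Computad := .ofEqv (preThetaByOne j)
  (fun ε g m h => by
    obtain ⟨y, x⟩ := g
    have hy := y.dim_le
    cases x with
    | face q δ =>
      have h1 : y.dim = m + 1 := by
        obtain rfl : q = 0 := Subsingleton.elim _ _
        simpa [preThetaByOne, dim_face, dim_top] using h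
      refine .gen _ ?_
      obtain rfl : q = 0 := Subsingleton.elim _ _
      simp [preThetaByOne, dim_face, h1, dim_bdTop (j := j) (m := m) (by omega) ε]
    | top =>
      have h1 : y.dim = m := by
        simp only [preThetaByOne, dim_top] at h ⊢
        omega
      subst h1
      exact (preThetaByOne_whisker ε y).1)
  (fun δ g m k h hk => by
    obtain ⟨y, x⟩ := g
    have hy := y.dim_le
    cases x with
    | face q η =>
      obtain rfl : q = 0 := Subsingleton.elim _ _
      have h1 : y.dim = m + 1 := by simpa [preThetaByOne, dim_face, dim_top] using h
      have hd : ∀ ε, (bdTop j m ε).dim = m := dim_bdTop (by omega)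
      have := fun ε => preThetaByOne_bd (k := m) η (bdTop j m ε) (hd ε).le (i := k)
        (by rw [hd]; exact hk) δ
      simpa [preThetaByOne, h1] using (this false).trans (this true).symm
    | top =>
      have h1 : y.dim = m := by
        simp only [preThetaByOne, dim_top] at h ⊢
        omega
      subst h1
      obtain ⟨i, hi⟩ : ∃ i, y.dim = i + 1 := ⟨y.dim - 1, by omega⟩
      exact .parallel (preThetaByOne_whisker false y).1 (preThetaByOne_whisker true y).1
        (i := i) (by omega) δ (((preThetaByOne_whisker false y).2 i hi δ).trans
          ((preThetaByOne_whisker true y).2 i hi δ).symm))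

/-- The map of generators underlying a morphism of computads. -/
def Computad.onGen {P Q : Computad} (f : P ⟶ Q) : P.Gen → Q.Gen :=
  Computad.Hom.toFun f

namespace ThetaOneBy

/-- The top generator `θ_{1;j}` of `Θ^{(1);(j)}`. -/
def theta (j : ℕ) : (ThetaOneBy j).Gen := (top, top)

/-- The generators `s_h θ_{0;j}` (`ε = false`) and `t_h θ_{0;j}` (`ε = true`) of `Θ^{(1);(j)}`. -/
def hTheta (ε : Bool) (j : ℕ) : (ThetaOneBy j).Gen := (face 0 ε, top)

/-- The inclusions `s_v` (`ε = false`) and `t_v` (`ε = true`) of `Θ^{(1);(j)}` into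
`Θ^{(1);(j+1)}`. -/
def vFace (ε : Bool) (j : ℕ) : ThetaOneBy j ⟶ ThetaOneBy (j + 1) where
  toFun g := (g.1, g.2.incl ε)
  dim_eq g := congrArg (g.1.dim + ·) (dim_incl ε g.2)
  bdry_eqv δ g m h := by
    have e : ((ThetaOneBy j).bdry δ g).map (fun g => (g.1, g.2.incl ε)) =
        (ThetaOneBy (j + 1)).bdry δ (g.1, g.2.incl ε) := by
      obtain ⟨x, y⟩ := g
      have hy := y.dim_le
      cases x with
      | face q η =>
        obtain rfl : q = 0 := Subsingleton.elim _ _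
        have h1 : y.dim = m + 1 := by
          have h : (face (0 : Fin 1) η).dim + y.dim = m + 1 := h
          simpa [dim_face] using h
        change CellTerm.gen (face 0 η, (bdTop j (y.dim - 1) δ).incl ε) =
          .gen (face 0 η, bdTop (j + 1) ((y.incl ε).dim - 1) δ)
        rw [dim_incl, incl_bdTop (by omega)]
      | top =>
        refine (map_whisker _ _ (fun m η => (top, bdTop (j + 1) m η)) _ _ _ ?_).trans ?_
        · intro i hi η
          exact congrArg (Prod.mk top) (incl_bdTop (hi.trans_le hy) ε η)
        · change _ = whisker _ _ (y.incl ε).dim _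
          rw [dim_incl]; rfl
    refine (congrArg (fun t => (ThetaOneBy (j + 1)).Eqv m t _) e).mpr ?_
    exact (ThetaOneBy (j + 1)).wf δ _ m ((congrArg (g.1.dim + ·) (dim_incl ε g.2)).trans h)

/-- The generators `s_v θ_{1;j}` (`ε = false`) and `t_v θ_{1;j}` (`ε = true`) of
`Θ^{(1);(j+1)}`. -/
def vTheta (ε : Bool) (j : ℕ) : (ThetaOneBy (j + 1)).Gen :=
  Computad.onGen (vFace ε j) (theta j)

end ThetaOneBy

namespace ThetaByOne

/-- The top generator `θ_{j;1}` of `Θ^{(j);(1)}`. -/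
def theta (j : ℕ) : (ThetaByOne j).Gen := (top, top)

/-- The generators `s_v θ_{j;0}` (`ε = false`) and `t_v θ_{j;0}` (`ε = true`) of `Θ^{(j);(1)}`. -/
def vTheta (ε : Bool) (j : ℕ) : (ThetaByOne j).Gen := (top, face 0 ε)

/-- The inclusions `s_h` (`ε = false`) and `t_h` (`ε = true`) of `Θ^{(j);(1)}` into
`Θ^{(j+1);(1)}`. -/
def hFace (ε : Bool) (j : ℕ) : ThetaByOne j ⟶ ThetaByOne (j + 1) where
  toFun g := (g.1.incl ε, g.2)
  dim_eq g := congrArg (· + g.2.dim) (dim_incl ε g.1)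
  bdry_eqv δ g m h := by
    have e : ((ThetaByOne j).bdry δ g).map (fun g => (g.1.incl ε, g.2)) =
        (ThetaByOne (j + 1)).bdry δ (g.1.incl ε, g.2) := by
      obtain ⟨y, x⟩ := g
      have hy := y.dim_le
      cases x with
      | face q η =>
        obtain rfl : q = 0 := Subsingleton.elim _ _
        have h1 : y.dim = m + 1 := by
          have h : y.dim + (face (0 : Fin 1) η).dim = m + 1 := h
          simpa [dim_face] using h
        change CellTerm.gen ((bdTop j (y.dim - 1) δ).incl ε, face 0 η) =
          .gen (bdTop (j + 1) ((y.incl ε).dim - 1) δ, face 0 η)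
        rw [dim_incl, incl_bdTop (by omega)]
      | top =>
        refine (map_whisker _ _ (fun m η => (bdTop (j + 1) m η, top)) _ _ _ ?_).trans ?_
        · intro i hi η
          exact congrArg (Prod.mk · top) (incl_bdTop (hi.trans_le hy) ε η)
        · change _ = whisker _ _ (y.incl ε).dim (.gen (_, face 0 (xor δ (y.incl ε).dim.bodd)))
          rw [dim_incl]; rfl
    refine (congrArg (fun t => (ThetaByOne (j + 1)).Eqv m t _) e).mpr ?_
    exact (ThetaByOne (j + 1)).wf δ _ m ((congrArg (· + g.2.dim) (dim_incl ε g.1)).trans h)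

/-- The generators `s_h θ_{j;1}` (`ε = false`) and `t_h θ_{j;1}` (`ε = true`) of
`Θ^{(j+1);(1)}`. -/
def hTheta (ε : Bool) (j : ℕ) : (ThetaByOne (j + 1)).Gen :=
  Computad.onGen (hFace ε j) (theta j)

end ThetaByOne

/-! The odd opposite of a globe is again that globe. Reversing the cells of dimension `m + 1`, for
`m` even, exchanges their `m`-dimensional sources and targets, so the isomorphism (`oddFlip`)
exchanges `s_m` with `t_m` for even `m` and fixes the top generator. In particular it exchanges
`a_-` with `a_+` and fixes `I`. The isomorphism `φ_j` sends `(x, y)` to the pair of flipped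
generators in the opposite order (`thetaOddSwap`).

What has to be checked is that boundaries correspond, and this reduces to counting signs modulo 2
(`map_thetaOddSwap_bdry`). For `(I, y)` with `dim y = n`, passing to the odd opposite exchanges
source and target according to the parity of `1 + n`, and reverses composition along `i`-cells
according to the parity of `i + 1`. The flip of `Θ^{(1)}` contributes one more sign to the face of
`y` that gets whiskered. The constant signs cancel in pairs. What remains is the parity of `n` in
the choice of the face and the parity of `n + i` in the side of the whiskering, which is how the
boundaries in `Θ^{(j);(1)}` are defined. The whiskering generators match because they are flipped
twice, once by the reversed composition (`oddOp_whisker`) and once by the bijection.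

The boundary expressions therefore agree literally. No equation of strict ω-categories is needed,
and a bijection of generators suffices for an isomorphism (`Computad.isoOfEquiv`).

The dependence on the parity of `j` comes from one generator: the inclusion of a face of `Θ^{(j+1)}`
sends the top generator to a `j`-dimensional face, and the flip exchanges the two such faces if and
only if `j + 1` is odd (`oddFlip_incl`). -/

/-! ### Isomorphisms of computads, and odd opposites of whiskered expressions -/

/-- A dimension-preserving bijection of generators that respects the boundary expressions is an
isomorphism of computads. -/
def Computad.isoOfEquiv {P Q : Computad} (e : P.Gen ≃ Q.Gen) (hdim : ∀ g, Q.dim (e g) = P.dim g)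
    (hbdry : ∀ ε g m, P.dim g = m + 1 → (P.bdry ε g).map e = Q.bdry ε (e g)) : P ≅ Q where
  hom := Computad.Hom.mk e hdim fun ε g m h => by
    -- `Eqv` is reflexive only on well-formed expressions, so even a literal equality of boundaries
    -- has to be completed by the well-formedness in `Q`.
    rw [hbdry ε g m h]
    exact Q.wf ε _ m ((hdim g).trans h)
  inv := Computad.Hom.mk e.symm (fun g => by rw [← hdim, e.apply_symm_apply]) fun ε g m h => by
    -- Once the generator is written as `e g`, its boundary is the renaming along `e` of the
    -- boundary of `g`, and renaming back along `e.symm` recovers the latter.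
    obtain ⟨g, rfl⟩ := e.surjective g
    have h1 : P.dim g = m + 1 := (hdim g).symm.trans h
    rw [← hbdry ε g m h1, CellTerm.map_map]
    simp only [e.symm_apply_apply, CellTerm.map_id]
    exact P.wf ε g m h1
  hom_inv_id := Computad.Hom.ext (funext e.symm_apply_apply)
  inv_hom_id := Computad.Hom.ext (funext e.apply_symm_apply)

/-- The odd opposite of a whiskered expression is whiskered on the other side in even dimensions. -/
theorem oddOp_whisker {G : Type} (I : ℕ → Bool → G) (left : ℕ → Bool) (k : ℕ) (x : CellTerm G) :
    (whisker I left k x).oddOp = whisker (fun m η => I m (xor η (m + 1).bodd))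
      (fun m => xor (left m) (m + 1).bodd) k x.oddOp := by
  induction k with
  | zero => rfl
  | succ m ih =>
    simp only [whisker]
    rw [← ih]
    cases left m <;> cases h : (m + 1).bodd <;>
      simp only [CellTerm.oddOp, h, cond_true, cond_false, Bool.xor_true, Bool.xor_false,
        Bool.not_true, Bool.not_false]

/-! ### The odd opposite of the walking `j`-morphism -/

namespace GlobeGen

/-- The isomorphism of the odd opposite of `Θ^{(j)}` with `Θ^{(j)}`, on generators: it exchanges the
source and the target in every even dimension. -/
def oddFlip {j : ℕ} : GlobeGen j → GlobeGen j
  | face k ε => face k (xor ε ((k : ℕ) + 1).bodd)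
  | top => top

theorem oddFlip_oddFlip {j : ℕ} (y : GlobeGen j) : y.oddFlip.oddFlip = y := by
  cases y <;> simp [oddFlip]

theorem dim_oddFlip {j : ℕ} (y : GlobeGen j) : y.oddFlip.dim = y.dim := by
  cases y <;> rfl

/-- No bound on `m` is needed: for `m ≥ j` both sides are the top generator, on which the sign has
no effect. -/
theorem oddFlip_bdTop (j m : ℕ) (ε : Bool) :
    (bdTop j m ε).oddFlip = bdTop j m (xor ε (m + 1).bodd) := by
  unfold bdTop
  split <;> rfl

/-- The sign `ε` matters only for the image of the top generator, a face of dimension `j`, which the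
flip exchanges according to the parity of `j + 1`. Every other face keeps its dimension and hence
its flip. This is the source of the case distinction between odd and even `j`. -/
theorem oddFlip_incl {j : ℕ} (ε : Bool) (y : GlobeGen j) :
    (y.incl ε).oddFlip = y.oddFlip.incl (xor ε (j + 1).bodd) := by
  cases y <;> rfl

end GlobeGen

/-! ### The isomorphism exchanging the two factors -/

/-- The bijection of the generators of `Θ^{(1);(j)}` and `Θ^{(j);(1)}` that exchanges the factors
and applies the odd flip to both. -/
def thetaOddSwap (j : ℕ) : GlobeGen 1 × GlobeGen j ≃ GlobeGen j × GlobeGen 1 where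
  toFun g := (g.2.oddFlip, g.1.oddFlip)
  invFun g := (g.2.oddFlip, g.1.oddFlip)
  left_inv g := by simp only [oddFlip_oddFlip]
  right_inv g := by simp only [oddFlip_oddFlip]

/-- The signs of the odd opposite cancel against those of the flips, leaving equal expressions and
not merely equal cells. Positive dimension matters: for a pair `(a_±, y)` with `dim y = 0` the
boundaries are junk values, which disagree if `j > 0`. -/
theorem map_thetaOddSwap_bdry {j : ℕ} (ε : Bool) (g : GlobeGen 1 × GlobeGen j) {m : ℕ}
    (h : (preThetaOneBy j).dim g = m + 1) :
    ((preThetaOneBy j).oddOp.bdry ε g).map (thetaOddSwap j) =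
      (preThetaByOne j).bdry ε (thetaOddSwap j g) := by
  obtain ⟨x, y⟩ := g
  cases x with
  | face q δ =>
    obtain rfl : q = 0 := Subsingleton.elim _ _
    have hy : y.dim = m + 1 := by simpa [preThetaOneBy, dim_face] using h
    change CellTerm.gen ((bdTop j (y.dim - 1) (xor ε (0 + y.dim).bodd)).oddFlip,
      (face 0 δ : GlobeGen 1).oddFlip) =
        .gen (bdTop j (y.oddFlip.dim - 1) ε, (face 0 δ : GlobeGen 1).oddFlip)
    -- The parity of `m + 1` enters twice and cancels: once because source and target of an `(m +
    -- 1)`-dimensional generator are exchanged, once because its `m`-dimensional faces are flipped.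
    rw [oddFlip_bdTop, dim_oddFlip, hy, zero_add, Nat.add_sub_cancel, Bool.xor_assoc,
      Bool.xor_self, Bool.xor_false]
  | top =>
    -- The side of the whiskering along `i`-cells: `1 + y.dim` comes from the reversal of `(I, y)`,
    -- `i + 1` from the reversal of the composition. The two summands `1` cancel.
    have hleft : ∀ i : ℕ, xor (!(xor ε (1 + y.dim).bodd)) (i + 1).bodd =
        !(xor (xor ε y.dim.bodd) i.bodd) := fun i => by
      simp only [Nat.bodd_add, Nat.bodd_one]
      cases ε <;> cases y.dim.bodd <;> cases i.bodd <;> rfl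
    -- The face that is whiskered: `0 + 1` is the sign with which the flip acts on the
    -- `0`-dimensional generators `a_±`. It cancels the `1` in `1 + y.dim`.
    have hface : xor (xor ε (1 + y.dim).bodd) (Nat.bodd (0 + 1)) = xor ε y.dim.bodd := by
      simp only [Nat.bodd_add, Nat.bodd_one]
      cases ε <;> cases y.dim.bodd <;> rfl
    change (whisker _ _ y.dim _).oddOp.map _ = whisker _ (fun i => !(xor (xor ε
      y.oddFlip.dim.bodd) i.bodd)) y.oddFlip.dim (.gen (_, face 0 (xor ε y.oddFlip.dim.bodd)))
    rw [oddOp_whisker, dim_oddFlip, map_whisker _ _ (fun i η => (bdTop j i η, top))]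
    · change whisker _ (fun i => xor (!(xor ε (1 + y.dim).bodd)) (i + 1).bodd) _
        (.gen (_, face 0 (xor (xor ε (1 + y.dim).bodd) (Nat.bodd (0 + 1))))) = _
      simp only [hleft, hface]
    -- The whiskering generators carry the sign of `i + 1` from `oddOp_whisker` and again from the
    -- flip, so they end up unflipped.
    · intro i _ η
      refine congrArg (Prod.mk · top) ?_
      rw [oddFlip_bdTop]
      simp

/-- The odd opposite of `Θ^{(1);(j)}` is isomorphic to `Θ^{(j);(1)}`. -/
def oddOpThetaOneByIso (j : ℕ) : (ThetaOneBy j).oddOp ≅ ThetaByOne j :=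
  Computad.isoOfEquiv (P := (ThetaOneBy j).oddOp) (Q := ThetaByOne j) (thetaOddSwap j)
    (fun g => (congrArg₂ (· + ·) (dim_oddFlip g.2) (dim_oddFlip g.1)).trans (add_comm _ _))
    fun ε g _ h => map_thetaOddSwap_bdry ε g h

/-! ### Compatibility with the faces, and the conclusion -/

/-- The isomorphisms are compatible with the inclusions of the faces. -/
theorem oddOpMap_vFace_comp (ε : Bool) (j : ℕ) :
    Computad.oddOpMap (ThetaOneBy.vFace ε j) ≫ (oddOpThetaOneByIso (j + 1)).hom =
      (oddOpThetaOneByIso j).hom ≫ ThetaByOne.hFace (xor ε (j + 1).bodd) j :=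
  -- Morphisms are determined by their maps of generators, and the face inclusions affect only the
  -- globe factor `y`, so the claim is the one about `oddFlip` and `incl`.
  Computad.Hom.ext (funext fun g => congrArg (Prod.mk · g.1.oddFlip) (oddFlip_incl ε g.2))

theorem oddOpThetaOneByIso_vTheta (ε : Bool) (j : ℕ) :
    Computad.onGen (oddOpThetaOneByIso (j + 1)).hom (ThetaOneBy.vTheta ε j) =
      ThetaByOne.hTheta (xor ε (j + 1).bodd) j :=
  rfl

theorem mainTheorem6 :
    ∃ φ : ∀ j : ℕ, (ThetaOneBy j).oddOp ≅ ThetaByOne j,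
      (∀ j : ℕ,
        Computad.onGen (φ j).hom (ThetaOneBy.theta j) = ThetaByOne.theta j ∧
        Computad.onGen (φ j).hom (ThetaOneBy.hTheta false j) = ThetaByOne.vTheta true j ∧
        Computad.onGen (φ j).hom (ThetaOneBy.hTheta true j) = ThetaByOne.vTheta false j) ∧
      (∀ j : ℕ, Odd (j + 1) →
        Computad.onGen (φ (j + 1)).hom (ThetaOneBy.vTheta false j) = ThetaByOne.hTheta true j ∧
        Computad.onGen (φ (j + 1)).hom (ThetaOneBy.vTheta true j) = ThetaByOne.hTheta false j ∧
        Computad.oddOpMap (ThetaOneBy.vFace false j) ≫ (φ (j + 1)).hom =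
          (φ j).hom ≫ ThetaByOne.hFace true j ∧
        Computad.oddOpMap (ThetaOneBy.vFace true j) ≫ (φ (j + 1)).hom =
          (φ j).hom ≫ ThetaByOne.hFace false j) ∧
      (∀ j : ℕ, Even (j + 1) →
        Computad.onGen (φ (j + 1)).hom (ThetaOneBy.vTheta false j) = ThetaByOne.hTheta false j ∧
        Computad.onGen (φ (j + 1)).hom (ThetaOneBy.vTheta true j) = ThetaByOne.hTheta true j ∧
        Computad.oddOpMap (ThetaOneBy.vFace false j) ≫ (φ (j + 1)).hom =
          (φ j).hom ≫ ThetaByOne.hFace false j ∧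
        Computad.oddOpMap (ThetaOneBy.vFace true j) ≫ (φ (j + 1)).hom =
          (φ j).hom ≫ ThetaByOne.hFace true j) := by
  -- The flips fix both top generators, hence `θ_{1;j}` goes to `θ_{j;1}`; they exchange `a_-` and
  -- `a_+` for every `j`, hence the other two correspondences.
  refine ⟨oddOpThetaOneByIso, fun j => ⟨rfl, rfl, rfl⟩, fun j hj => ?_, fun j hj => ?_⟩
  all_goals
    have h1 := fun ε => oddOpThetaOneByIso_vTheta ε j
    have h2 := fun ε => oddOpMap_vFace_comp ε j
  -- Once the parity is a literal Boolean, the sign `xor ε (j + 1).bodd` evaluates: it is negated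
  -- here and unchanged in the even case.
  · have hb : (j + 1).bodd = true := by
      rw [Nat.odd_iff, Nat.mod_two_of_bodd] at hj
      simpa using hj
    rw [hb] at h1 h2
    exact ⟨h1 false, h1 true, h2 false, h2 true⟩
  · have hb : (j + 1).bodd = false := by
      rw [Nat.even_iff, Nat.mod_two_of_bodd] at hj
      simpa using hj
    rw [hb] at h1 h2
    exact ⟨h1 false, h1 true, h2 false, h2 true⟩
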